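/- For $\theta\in\mathbb{R}$, $t>0$, $x\in\mathbb{R}$ let $r_\theta(t,x)=\exp\left(-\frac{\theta^2}{2t}+\frac{\theta x}{t}\right)$. Let $b\colon[0,\infty)\to\mathbb{R}$ be concave and real analytic on $(0,\infty)$, with $b(0)>0$ and a finite (right) derivative at $0$. Fix $t_0>0$ and $x_0<b(t_0)$. All measures below are positive Borel measures, and $\|\lambda\|$ denotes total mass. Consider the linear programs * $(D_1)$: maximise $\int r_\theta(t_0,x_0)\,\mu(d\theta)$ over finite measures $\mu$ on $[2b(0),\infty)$ with $\int r_\theta(t,b(t))\,\mu(d\theta)\le 1$ for all $t\in(0,t_0]$; * $(P_2)$: minimise $\int r_\theta(t_0,x_0)\,\mu(d\theta)$ over finite measures $\mu$ on $[2b(0),\infty)$ with $\int r_\theta(t,b(t))\,\mu(d\theta)\ge 1$ for all $t\in(0,t_0]$; * $(P_1)$: minimise $\|\lambda\|$ over finite measures $\lambda$ on $(0,t_0]$ with $\int r_\theta(t,b(t))\,\lambda(dt)\ge r_\theta(t_0,x_0)$ for all $\theta\in[2b(0),\infty)$; * $(D_2)$: maximise $\|\lambda\|$ over finite measures $\lambda$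 on $(0,t_0]$ with $\int r_\theta(t,b(t))\,\lambda(dt)\le r_\theta(t_0,x_0)$ for all $\theta\in[2b(0),\infty)$. For $\varepsilon\in(0,t_0]$ let $(P_{1,\varepsilon})$ and $(D_{2,\varepsilon})$ be the programs obtained from $(P_1)$ and $(D_2)$ by replacing $(0,t_0]$ by $[\varepsilon,t_0]$. By an optimiser of $(D_1)$ (resp. $(P_2)$) we mean a measure on $[2b(0),\infty)$, of possibly infinite total mass, that satisfies the constraints of the program and whose value of the objective is at least (resp. at most) that of every finite measure satisfying the constraints. Assume (B): there is a sequence $(\varepsilon_n)$ in $(0,t_0]$ with $\varepsilon_n\to0$ and there are optimisers $\lambda_{1,\varepsilon_n}$ of $(P_{1,\varepsilon_n})$ that converge vaguely on $(0,t_0]$ to a finite measure $\lambda$ on $(0,t_0]$ with $\|\lambda_{1,\varepsilon_n}\|\to\|\lambda\|$; and likewise, for a possibly different sequence, there are optimisers of $(D_{2,\varepsilon_n})$ that converge vaguely on $(0,t_0]$ to a finite measure on $(0,t_0]$ without loss of mass in the limit. Theorem. Let $\mu_1,\mu_2,\lambda_1,\lambda_2$ be optimisers of $(D_1),(P_2),(P_1),(D_2)$,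 respectively, and assume that for some $t^*>t_0$ $$\int_{(0,\infty)}\exp\left(-\frac{\theta^2}{2t^*}\right)\mu_i(d\theta)<\infty,\qquad i=1,2.$$ Suppose that at least one of the following holds: 1. $\lambda_1(\{t_0\})=0$; 2. $\lambda_2([t_0-\varepsilon,t_0])>0$ for every $\varepsilon\in(0,t_0)$. Then $b$ is representable on $[0,t_0]$: there is a $\sigma$-finite measure $\mu$ on $(0,\infty)$ such that $\int_{(0,\infty)} r_\theta(t,b(t))\,\mu(d\theta)=1$ for all $t\in(0,t_0]$. -/

import Mathlib

open Set Filter Topology MeasureTheory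
open scoped ENNReal

noncomputable section

namespace ImagesLP

/-- The kernel `r_θ(t, x) = exp (-θ² / (2t) + θ x / t)` (used for `t > 0` only). -/
def imageKernel (θ t x : ℝ) : ℝ :=
  Real.exp (-θ ^ 2 / (2 * t) + θ * x / t)

/-- `r_μ(t, x) = ∫ r_θ(t, x) μ(dθ)`, as an extended non-negative number. -/
def imageIntegral (μ : Measure ℝ) (t x : ℝ) : ℝ≥0∞ :=
  ∫⁻ θ, ENNReal.ofReal (imageKernel θ t x) ∂μ

/-- `∫ r_θ(t, b(t)) lam(dt)`, as an extended non-negative number. -/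
def timeIntegral (b : ℝ → ℝ) (lam : Measure ℝ) (θ : ℝ) : ℝ≥0∞ :=
  ∫⁻ t, ENNReal.ofReal (imageKernel θ t (b t)) ∂lam

/-- A measure on the line is a measure on `S` if the complement of `S` is a null set. -/
def IsMeasureOn (S : Set ℝ) (ν : Measure ℝ) : Prop :=
  ν Sᶜ = 0

/-- The cone of finite positive (Borel, hence regular) measures on `S`. -/
def IsFiniteMeasureOn (S : Set ℝ) (ν : Measure ℝ) : Prop :=
  IsFiniteMeasure ν ∧ IsMeasureOn S ν

/-- The boundary `b` is representable up to `T < ∞` in the sense of the method of images: there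
is a positive `σ`-finite measure `μ` on `(0, ∞)` with `r_μ(t, b(t)) = 1` for all `t ∈ (0, T]`. -/
def RepresentableUpTo (b : ℝ → ℝ) (T : ℝ) : Prop :=
  ∃ μ : Measure ℝ, SigmaFinite μ ∧ IsMeasureOn (Ioi 0) μ ∧
    ∀ t ∈ Ioc 0 T, imageIntegral μ t (b t) = 1

/-- Concave boundaries `b : [0, ∞) → ℝ`, analytic on `(0, ∞)`, with `b(0) > 0` and finite slope
at `0` (in particular continuous at `0`). Only the values of `b` on `[0, ∞)` matter. -/
structure IsBoundary (b : ℝ → ℝ) : Prop where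
  analytic : AnalyticOnNhd ℝ b (Ioi 0)
  concave : ConcaveOn ℝ (Ici 0) b
  pos : 0 < b 0
  slope : DifferentiableWithinAt ℝ b (Ici 0) 0

/-! ### The programs over measures in `θ`

`(D₁)`: maximise `∫ r_θ(t₀, x₀) μ(dθ)` over finite positive measures `μ` on `[2b(0), ∞)` with
`∫ r_θ(t, b(t)) μ(dθ) ≤ 1` for all `t ∈ (0, t₀]`.
`(P₂)`: minimise the same integral under the reverse constraints `≥ 1`. -/

/-- The constraints of `(D₁)`, for a measure on `[2b(0), ∞)` of possibly infinite mass. -/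
def D1Admissible (b : ℝ → ℝ) (t₀ : ℝ) (μ : Measure ℝ) : Prop :=
  IsMeasureOn (Ici (2 * b 0)) μ ∧ ∀ t ∈ Ioc 0 t₀, imageIntegral μ t (b t) ≤ 1

/-- `μ` is a maximiser of `(D₁)`: it is admissible, and its value is at least that of every
admissible finite measure. The mass of `μ` itself may be infinite. -/
def D1Optimal (b : ℝ → ℝ) (t₀ x₀ : ℝ) (μ : Measure ℝ) : Prop :=
  D1Admissible b t₀ μ ∧
    ∀ μ' : Measure ℝ, IsFiniteMeasure μ' → D1Admissible b t₀ μ' →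
      imageIntegral μ' t₀ x₀ ≤ imageIntegral μ t₀ x₀

/-- The constraints of `(P₂)`, for a measure on `[2b(0), ∞)` of possibly infinite mass. -/
def P2Admissible (b : ℝ → ℝ) (t₀ : ℝ) (μ : Measure ℝ) : Prop :=
  IsMeasureOn (Ici (2 * b 0)) μ ∧ ∀ t ∈ Ioc 0 t₀, 1 ≤ imageIntegral μ t (b t)

/-- `μ` is a minimiser of `(P₂)`: it is admissible, and its value is at most that of every
admissible finite measure. The mass of `μ` itself may be infinite. -/
def P2Optimal (b : ℝ → ℝ) (t₀ x₀ : ℝ) (μ : Measure ℝ) : Prop :=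
  P2Admissible b t₀ μ ∧
    ∀ μ' : Measure ℝ, IsFiniteMeasure μ' → P2Admissible b t₀ μ' →
      imageIntegral μ t₀ x₀ ≤ imageIntegral μ' t₀ x₀

/-! ### The programs over measures in `t`

`(P₁)`: minimise the total variation of a finite positive measure `lam` on `(0, t₀]` with
`∫ r_θ(t, b(t)) lam(dt) ≥ r_θ(t₀, x₀)` for all `θ ≥ 2b(0)`.
`(D₂)`: maximise the total variation under the reverse constraints `≤ r_θ(t₀, x₀)`.

The time set `S` is `(0, t₀]` for the programs `(P₁)`, `(D₂)` and `[ε, t₀]` for the restricted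
programs `(P₁,ε)`, `(D₂,ε)`. The total variation of `lam` is `lam univ`. -/

/-- Admissibility for `(P₁)` with time set `S`. -/
def P1Admissible (b : ℝ → ℝ) (t₀ x₀ : ℝ) (S : Set ℝ) (lam : Measure ℝ) : Prop :=
  IsFiniteMeasureOn S lam ∧
    ∀ θ ∈ Ici (2 * b 0), ENNReal.ofReal (imageKernel θ t₀ x₀) ≤ timeIntegral b lam θ

/-- Minimisers of the total variation in `(P₁)` with time set `S`. -/
def P1Optimal (b : ℝ → ℝ) (t₀ x₀ : ℝ) (S : Set ℝ) (lam : Measure ℝ) : Prop :=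
  P1Admissible b t₀ x₀ S lam ∧
    ∀ lam' : Measure ℝ, P1Admissible b t₀ x₀ S lam' → lam univ ≤ lam' univ

/-- Admissibility for `(D₂)` with time set `S`. -/
def D2Admissible (b : ℝ → ℝ) (t₀ x₀ : ℝ) (S : Set ℝ) (lam : Measure ℝ) : Prop :=
  IsFiniteMeasureOn S lam ∧
    ∀ θ ∈ Ici (2 * b 0), timeIntegral b lam θ ≤ ENNReal.ofReal (imageKernel θ t₀ x₀)

/-- Maximisers of the total variation in `(D₂)` with time set `S`. -/
def D2Optimal (b : ℝ → ℝ) (t₀ x₀ : ℝ) (S : Set ℝ) (lam : Measure ℝ) : Prop :=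
  D2Admissible b t₀ x₀ S lam ∧
    ∀ lam' : Measure ℝ, D2Admissible b t₀ x₀ S lam' → lam' univ ≤ lam univ

/-- Vague convergence on `(0, t₀]` of measures on `(0, t₀]`: the functions in `C_c((0, t₀])` are
the restrictions of the continuous functions on `ℝ` with compact support inside `(0, ∞)`. -/
def VagueTendsto (lams : ℕ → Measure ℝ) (lam : Measure ℝ) : Prop :=
  ∀ f : ℝ → ℝ, Continuous f → HasCompactSupport f → tsupport f ⊆ Ioi 0 →
    Tendsto (fun n => ∫ t, f t ∂(lams n)) atTop (𝓝 (∫ t, f t ∂lam))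

/-- For some sequence `ε n → 0` in `(0, t₀]` there are optimisers of the restricted programs on
`[ε n, t₀]` that converge vaguely on `(0, t₀]` to a finite measure without loss of mass.
`Opt S lam` says that `lam` is an optimiser of the program with time set `S`. -/
def HasLimitWithoutMassLoss (t₀ : ℝ) (Opt : Set ℝ → Measure ℝ → Prop) : Prop :=
  ∃ (ε : ℕ → ℝ) (lams : ℕ → Measure ℝ) (lam : Measure ℝ),
    (∀ n, ε n ∈ Ioc 0 t₀) ∧ Tendsto ε atTop (𝓝 0) ∧
    (∀ n, Opt (Icc (ε n) t₀) (lams n)) ∧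
    IsFiniteMeasureOn (Ioc 0 t₀) lam ∧
    VagueTendsto lams lam ∧
    Tendsto (fun n => lams n univ) atTop (𝓝 (lam univ))

/-- The boundary satisfies the standing assumption, and optimisers of the restricted programs
`(P₁,ε)` and `(D₂,ε)` have vague limits without loss of mass as `ε → 0`. -/
structure AssumptionB (b : ℝ → ℝ) (t₀ x₀ : ℝ) : Prop where
  boundary : IsBoundary b
  limit_P1 : HasLimitWithoutMassLoss t₀ (P1Optimal b t₀ x₀)
  limit_D2 : HasLimitWithoutMassLoss t₀ (D2Optimal b t₀ x₀)

end ImagesLP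

end

/-! By Tonelli, integrating `r_μ(t, b(t))` against a time measure `λ` is the same as integrating the
time integral of `λ` against `μ`. Once the values of a dual pair agree, the time constraint of an
optimal pair must be tight, that is, `r_μ(t, b(t)) = 1` for `λ`-almost every `t`. The Gaussian
moment condition makes `t ↦ r_μ(t, b(t))` analytic on `(0, t*)`, an interval with `t₀` in its
interior, so tightness at points accumulating at `t₀` from the left spreads to all of `(0, t₀]`.
Comparing growth as `θ → ∞` shows that `λ₁` charges every `(s, t₀]` and that `λ₂` has no atom at
`t₀`; either alternative then gives mass in every `(s, t₀)`.

The core is the absence of a duality gap although `(0, t₀]` is not compact. For each `θ ≥ 2b(0)` the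
kernel extends continuously to `t = 0`, so Farkas' lemma applies on `[0, t₀]`, at the price of a
possible atom at `0`. The extended kernel vanishes there for `θ > 2b(0)`, so the atom is felt only
at `θ = 2b(0)`. In `exists_p1Admissible_le` it is dropped and the endpoint constraint recovered by
continuity; in `exists_d2Admissible_ge` it is moved to a small positive time at the cost of a factor
`1 - η`. -/

/-! ### Farkas' lemma on a compact space -/

section Farkas

variable {X ι : Type*} [TopologicalSpace X]

/-- The cone of all pairs dominated by a conic combination of the pairs `(g i, d i)`: smaller in
the first component and larger in the second. -/
def dominatedCone (g : ι → C(X, ℝ)) (d : ι → ℝ) : PointedCone ℝ (C(X, ℝ) × ℝ) where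
  carrier := {p | ∃ w : ι →₀ ℝ, 0 ≤ w ∧ p.1 ≤ Finsupp.linearCombination ℝ g w ∧
    Finsupp.linearCombination ℝ d w ≤ p.2}
  add_mem' := by
    rintro p q ⟨v, hv, hv1, hv2⟩ ⟨w, hw, hw1, hw2⟩
    exact ⟨v + w, add_nonneg hv hw, by simpa using add_le_add hv1 hw1,
      by simpa using add_le_add hv2 hw2⟩
  zero_mem' := ⟨0, le_rfl, by simp, by simp⟩
  smul_mem' := by
    rintro c p ⟨v, hv, hv1, hv2⟩
    refine ⟨(c : ℝ) • v, smul_nonneg c.2 hv, ?_, ?_⟩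
    · rw [map_smul]
      intro x
      exact mul_le_mul_of_nonneg_left (hv1 x) c.2
    · rw [map_smul]
      exact mul_le_mul_of_nonneg_left hv2 c.2

theorem mem_dominatedCone_self (g : ι → C(X, ℝ)) (d : ι → ℝ) (i : ι) :
    (g i, d i) ∈ dominatedCone g d :=
  ⟨Finsupp.single i 1, by simp, by simp, by simp⟩

theorem mem_dominatedCone_of_nonpos (g : ι → C(X, ℝ)) (d : ι → ℝ) {f : C(X, ℝ)} (hf : f ≤ 0) :
    (f, (0 : ℝ)) ∈ dominatedCone g d :=
  ⟨0, le_rfl, by simpa using hf, by simp⟩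

/-- **Farkas' lemma** for systems of linear inequalities in a positive measure on a compact space. -/
theorem exists_measure_integral_le [CompactSpace X] [T2Space X] [MeasurableSpace X] [BorelSpace X]
    (g : ι → C(X, ℝ)) (d : ι → ℝ) (i₀ : ι) (hi₀ : ∀ x, 0 < g i₀ x)
    (H : ∀ w : ι →₀ ℝ, 0 ≤ w → (∀ x, 0 ≤ w.sum fun i a => a * g i x) →
      0 ≤ w.sum fun i a => a * d i) :
    ∃ ν : Measure X, IsFiniteMeasure ν ∧ ∀ i, ∫ x, g i x ∂ν ≤ d i := by
  have eval (w : ι →₀ ℝ) (x : X) :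
      Finsupp.linearCombination ℝ g w x = w.sum fun i a => a * g i x := by
    simp [Finsupp.linearCombination_apply, Finsupp.sum]
  have evald (w : ι →₀ ℝ) :
      Finsupp.linearCombination ℝ d w = w.sum fun i a => a * d i := by
    simp [Finsupp.linearCombination_apply]
  -- The second coordinate on this line is nonnegative on the cone by `H`; M. Riesz extension
  -- carries it to the whole space.
  let S : Submodule ℝ (C(X, ℝ) × ℝ) := Submodule.span ℝ {(0, 1)}
  obtain ⟨G, hG1, hG2⟩ : ∃ G : C(X, ℝ) × ℝ →ₗ[ℝ] ℝ,
      (∀ x : S, G x = (x : C(X, ℝ) × ℝ).2) ∧ ∀ p ∈ dominatedCone g d, 0 ≤ G p := by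
    refine riesz_extension (dominatedCone g d) ⟨S, (LinearMap.snd ℝ C(X, ℝ) ℝ).domRestrict S⟩ ?_ ?_
    · rintro ⟨x, hx⟩ ⟨w, hw, hw1, hw2⟩
      obtain ⟨r, rfl⟩ := Submodule.mem_span_singleton.1 hx
      refine le_trans (H w hw fun x => ?_) (evald w ▸ hw2)
      rw [← eval]
      simpa using hw1 x
    · rintro ⟨f, r⟩
      -- Extension requires the line to reach the cone from every pair. A multiple of the strictly
      -- positive `g i₀` dominates any `f`, which is the role of `i₀`.
      obtain ⟨δ, hδ, hδg⟩ : ∃ δ > 0, ∀ x, δ ≤ g i₀ x := by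
        rcases isEmpty_or_nonempty X with h | h
        · exact ⟨1, one_pos, fun x => h.elim x⟩
        · obtain ⟨x, -, hx⟩ := isCompact_univ.exists_isMinOn univ_nonempty
            (g i₀).continuous.continuousOn
          exact ⟨g i₀ x, hi₀ x, fun y => hx (mem_univ y)⟩
      refine ⟨⟨(‖f‖ / δ * d i₀ - r) • ((0, 1) : C(X, ℝ) × ℝ),
        Submodule.mem_span_singleton.2 ⟨_, rfl⟩⟩, Finsupp.single i₀ (‖f‖ / δ), ?_, ?_, ?_⟩
      · simp only [Finsupp.single_nonneg]; positivity
      · have h : f ≤ Finsupp.linearCombination ℝ g (Finsupp.single i₀ (‖f‖ / δ)) := by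
          intro x
          change f x ≤ Finsupp.linearCombination ℝ g (Finsupp.single i₀ (‖f‖ / δ)) x
          rw [eval, Finsupp.sum_single_index (by simp)]
          calc f x ≤ ‖f‖ := (le_abs_self _).trans (f.norm_coe_le_norm x)
            _ = ‖f‖ / δ * δ := by field_simp
            _ ≤ _ := by gcongr; exact hδg x
        simpa using h
      · simp
  -- The cone contains `(-f, 0)` for `f ≥ 0`, so the sign flip yields a positive functional. Since
  -- `G (0, 1) = 1`, nonnegativity of `G` at `(g i, d i)` is the desired inequality.
  let Λ₀ : C(X, ℝ) →ₗ[ℝ] ℝ := -(G ∘ₗ LinearMap.inl ℝ C(X, ℝ) ℝ)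
  let e : CompactlySupportedContinuousMap X ℝ →ₗ[ℝ] C(X, ℝ) :=
    { toFun := fun f => f.toContinuousMap, map_add' := fun _ _ => rfl, map_smul' := fun _ _ => rfl }
  let Λ : CompactlySupportedContinuousMap X ℝ →ₚ[ℝ] ℝ := PositiveLinearMap.mk₀ (Λ₀ ∘ₗ e) (by
    intro f hf
    have h := hG2 _ (mem_dominatedCone_of_nonpos g d (f := -e f) (fun x => neg_nonpos.2 (hf x)))
    have : ((-e f, (0 : ℝ)) : C(X, ℝ) × ℝ) = -(e f, 0) := by simp
    rw [this, map_neg] at h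
    exact h)
  refine ⟨RealRMK.rieszMeasure Λ, ?_, fun i => ?_⟩
  · have : IsFiniteMeasureOnCompacts (RealRMK.rieszMeasure Λ) := by
      unfold RealRMK.rieszMeasure
      infer_instance
    exact ⟨this.lt_top_of_isCompact isCompact_univ⟩
  · have h := RealRMK.integral_rieszMeasure Λ
      (CompactlySupportedContinuousMap.continuousMapEquiv (g i))
    have h2 : Λ (CompactlySupportedContinuousMap.continuousMapEquiv (g i)) = -G (g i, 0) := rfl
    rw [h2] at h
    have h3 := hG2 _ (mem_dominatedCone_self g d i)
    have h4 : G (0, 1) = 1 := hG1 ⟨(0, 1), Submodule.mem_span_singleton_self _⟩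
    have h5 : ((g i, d i) : C(X, ℝ) × ℝ) = (g i, 0) + d i • (0, 1) := by simp
    rw [h5, map_add, map_smul, h4, smul_eq_mul] at h3
    change ∫ x, g i x ∂_ = _ at h
    linarith

end Farkas

/-! ### Analyticity of Gaussian integrals in time -/

/-- A real analytic function extends to a complex analytic function near each point. -/
theorem AnalyticAt.exists_complex_extension {f : ℝ → ℝ} {x : ℝ} (hf : AnalyticAt ℝ f x) :
    ∃ F : ℂ → ℂ, AnalyticAt ℂ F x ∧ ∀ᶠ y : ℝ in 𝓝 x, F y = f y := by
  obtain ⟨p, r, hp⟩ := hf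
  let q : FormalMultilinearSeries ℂ ℂ ℂ :=
    FormalMultilinearSeries.ofScalars ℂ (fun n => (p.coeff n : ℂ))
  obtain ⟨s, hs0, hsr⟩ := ENNReal.lt_iff_exists_nnreal_btwn.1 hp.r_pos
  have hs0' : 0 < s := by exact_mod_cast hs0
  obtain ⟨C, -, hC⟩ := p.norm_mul_pow_le_of_lt_radius (hsr.trans_le hp.r_le)
  have hq : (s : ℝ≥0∞) ≤ q.radius := by
    refine q.le_radius_of_bound C fun n => ?_
    have : ‖q n‖ = ‖p n‖ := by
      rw [FormalMultilinearSeries.ofScalars_norm, Complex.norm_real,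
        FormalMultilinearSeries.norm_apply_eq_norm_coef]
    rw [this]; exact hC n
  have hqs := (q.hasFPowerSeriesOnBall (hs0.trans_le hq))
  refine ⟨fun z => q.sum (z - x), ?_, ?_⟩
  · have h0 : AnalyticAt ℂ q.sum ((x : ℂ) - x) := by simpa using hqs.analyticAt
    exact h0.comp (f := fun z : ℂ => z - x) (by fun_prop)
  · filter_upwards [Metric.ball_mem_nhds x hs0'] with y hy
    have hy' : ‖y - x‖ < s := by simpa [dist_eq_norm] using hy
    have h1 := hp.hasSum (y := y - x) (by
      simp only [Metric.mem_eball, edist_zero_right]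
      refine lt_trans ?_ hsr
      rw [← ofReal_norm, ENNReal.ofReal_lt_iff_lt_toReal (norm_nonneg _) (by simp)]
      simpa using hy')
    have h2 : q.sum ((y : ℂ) - x) = ∑' n, ((p n fun _ => y - x : ℝ) : ℂ) := by
      unfold FormalMultilinearSeries.sum
      congr 1 with n
      simp [q, FormalMultilinearSeries.apply_eq_prod_smul_coeff]
    simp only [h2, ← Complex.ofReal_tsum, h1.tsum_eq]
    simp

/-- Integrals of exponentials with analytic parameters are analytic where they are dominated. -/
theorem analyticAt_integral_cexp {μ : Measure ℝ} {κ : ℝ} {u v : ℂ → ℂ} {z₀ : ℂ}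
    (hμ : Integrable (fun θ : ℝ => Real.exp (-κ * θ ^ 2)) μ)
    (hu : AnalyticAt ℂ u z₀) (hv : AnalyticAt ℂ v z₀) (hκ : κ < (u z₀).re) :
    AnalyticAt ℂ (fun z => ∫ θ : ℝ, Complex.exp (-u z * θ ^ 2 + v z * θ) ∂μ) z₀ := by
  -- The gap `κ' - κ` absorbs the linear exponent and the polynomial factor of the derivative.
  obtain ⟨κ', hκ1, hκ2⟩ := exists_between hκ
  have c1 : ∀ᶠ z in 𝓝 z₀, κ' < (u z).re :=
    (Complex.continuous_re.continuousAt.comp hu.continuousAt).eventually (lt_mem_nhds hκ2)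
  have c2 : ∀ᶠ z in 𝓝 z₀, ‖v z‖ < ‖v z₀‖ + 1 :=
    hv.continuousAt.norm.eventually (gt_mem_nhds (by linarith))
  have c3 : ∀ᶠ z in 𝓝 z₀, ‖deriv v z‖ < ‖deriv v z₀‖ + 1 :=
    hv.deriv.continuousAt.norm.eventually (gt_mem_nhds (by linarith))
  have c4 : ∀ᶠ z in 𝓝 z₀, ‖deriv u z‖ < ‖deriv u z₀‖ + 1 :=
    hu.deriv.continuousAt.norm.eventually (gt_mem_nhds (by linarith))
  set M := ‖v z₀‖ + 1
  set A := ‖deriv u z₀‖ + 1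
  set B := ‖deriv v z₀‖ + 1
  have hgood : ∀ᶠ z in 𝓝 z₀, (AnalyticAt ℂ u z ∧ AnalyticAt ℂ v z) ∧
      κ' < (u z).re ∧ ‖v z‖ < M ∧ ‖deriv v z‖ < B ∧ ‖deriv u z‖ < A := by
    filter_upwards [hu.eventually_analyticAt, hv.eventually_analyticAt, c1, c2, c3, c4]
      with z h1 h2 h3 h4 h5 h6 using ⟨⟨h1, h2⟩, h3, h4, h5, h6⟩
  obtain ⟨r, hr, hball⟩ := Metric.eventually_nhds_iff_ball.1 hgood
  have hA : 0 < A := by positivity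
  have hB : 0 < B := by positivity
  have hM : 0 < M := by positivity
  let C := (2 * A + B) * Real.exp ((M + 1) ^ 2 / (4 * (κ' - κ)))
  -- The spare factor `E` lets one estimate serve the integrand (`E = 1`) and its derivative (`E =
  -- exp |θ|`).
  have hnorm : ∀ z ∈ Metric.ball z₀ r, ∀ θ : ℝ, ∀ E : ℝ, 0 ≤ E → E ≤ Real.exp |θ| →
      ‖Complex.exp (-u z * θ ^ 2 + v z * θ)‖ * E ≤
      Real.exp ((M + 1) ^ 2 / (4 * (κ' - κ))) * Real.exp (-κ * θ ^ 2) := by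
    intro z hz θ E hE0 hE
    obtain ⟨-, h1, h2, -, -⟩ := hball z hz
    rw [Complex.norm_exp]
    calc _ ≤ Real.exp (-κ' * θ ^ 2 + M * |θ|) * Real.exp |θ| := by
          gcongr
          have e1 : (-u z * (θ : ℂ) ^ 2 + v z * θ).re = -(u z).re * θ ^ 2 + (v z).re * θ := by
            rw [← Complex.ofReal_pow]; simp [-Complex.ofReal_pow]
          rw [e1]
          have e2 : (v z).re * θ ≤ M * |θ| := by
            refine (le_abs_self _).trans ?_
            rw [abs_mul]
            gcongr
            exact (Complex.abs_re_le_norm _).trans h2.le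
          nlinarith [sq_nonneg θ]
      _ ≤ _ := by
          rw [← Real.exp_add, ← Real.exp_add]
          apply Real.exp_le_exp.2
          have hd : 0 < κ' - κ := by linarith
          have : (M + 1) * |θ| - (κ' - κ) * θ ^ 2 ≤ (M + 1) ^ 2 / (4 * (κ' - κ)) := by
            rw [le_div_iff₀ (by positivity), ← sq_abs θ]
            nlinarith [sq_nonneg ((M + 1) - 2 * (κ' - κ) * |θ|)]
          linarith
  have hderiv : ∀ z ∈ Metric.ball z₀ r, ∀ θ : ℝ,
      HasDerivAt (fun z => Complex.exp (-u z * θ ^ 2 + v z * θ))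
        (Complex.exp (-u z * θ ^ 2 + v z * θ) * (-deriv u z * θ ^ 2 + deriv v z * θ)) z := by
    intro z hz θ
    obtain ⟨⟨h1, h2⟩, -⟩ := hball z hz
    exact ((h1.differentiableAt.hasDerivAt.neg.mul_const _).add
      (h2.differentiableAt.hasDerivAt.mul_const _)).cexp
  have hbound : ∀ z ∈ Metric.ball z₀ r, ∀ θ : ℝ,
      ‖Complex.exp (-u z * θ ^ 2 + v z * θ) * (-deriv u z * θ ^ 2 + deriv v z * θ)‖ ≤
        C * Real.exp (-κ * θ ^ 2) := by
    intro z hz θ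
    obtain ⟨-, -, -, h3, h4⟩ := hball z hz
    rw [norm_mul]
    have e1 : ‖-deriv u z * θ ^ 2 + deriv v z * θ‖ ≤ A * |θ| ^ 2 + B * |θ| := by
      refine (norm_add_le _ _).trans ?_
      simp only [norm_mul, norm_neg, norm_pow, Complex.norm_real, Real.norm_eq_abs]
      gcongr
    have e2 : |θ| ^ 2 ≤ 2 * Real.exp |θ| := by
      have := Real.quadratic_le_exp_of_nonneg (abs_nonneg θ)
      nlinarith [abs_nonneg θ]
    have e3 : |θ| ≤ Real.exp |θ| := by linarith [Real.add_one_le_exp |θ|]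
    have e4 : ‖-deriv u z * θ ^ 2 + deriv v z * θ‖ ≤ (2 * A + B) * Real.exp |θ| := by
      refine e1.trans ?_
      nlinarith
    calc _ ≤ ‖Complex.exp (-u z * θ ^ 2 + v z * θ)‖ * ((2 * A + B) * Real.exp |θ|) := by gcongr
      _ = (2 * A + B) * (‖Complex.exp (-u z * θ ^ 2 + v z * θ)‖ * Real.exp |θ|) := by ring
      _ ≤ (2 * A + B) * (Real.exp ((M + 1) ^ 2 / (4 * (κ' - κ))) * Real.exp (-κ * θ ^ 2)) :=
          mul_le_mul_of_nonneg_left (hnorm z hz θ _ (Real.exp_pos _).le le_rfl) (by positivity)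
      _ = _ := by simp only [C]; ring
  have hmeas : ∀ z, AEStronglyMeasurable
      (fun θ : ℝ => Complex.exp (-u z * θ ^ 2 + v z * θ)) μ := fun z =>
    Continuous.aestronglyMeasurable (by fun_prop)
  have hdiff : DifferentiableOn ℂ
      (fun z => ∫ θ : ℝ, Complex.exp (-u z * θ ^ 2 + v z * θ) ∂μ) (Metric.ball z₀ r) := by
    intro z hz
    refine (hasDerivAt_integral_of_dominated_loc_of_deriv_le
      (Metric.isOpen_ball.mem_nhds hz) (Eventually.of_forall hmeas) ?_
      (Continuous.aestronglyMeasurable (by fun_prop))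
      (Eventually.of_forall fun θ z hz => hbound z hz θ) (hμ.const_mul C)
      (Eventually.of_forall fun θ z hz => hderiv z hz θ)).2.differentiableAt.differentiableWithinAt
    refine Integrable.mono' (hμ.const_mul (Real.exp ((M + 1) ^ 2 / (4 * (κ' - κ))))) (hmeas z)
       (Eventually.of_forall fun θ => ?_)
    simpa using hnorm z hz θ 1 zero_le_one (Real.one_le_exp (abs_nonneg θ))
  exact hdiff.analyticAt (Metric.ball_mem_nhds z₀ hr)

namespace ImagesLP

/-- `t ↦ r_μ(t, b(t))` is analytic where the Gaussian moments of `μ` are finite. -/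
theorem analyticAt_integral_imageKernel {μ : Measure ℝ} {b : ℝ → ℝ} {t T : ℝ} (ht : 0 < t)
    (hT : t < T) (hb : AnalyticAt ℝ b t)
    (hμ : Integrable (fun θ : ℝ => Real.exp (-θ ^ 2 / (2 * T))) μ) :
    AnalyticAt ℝ (fun s => ∫ θ, imageKernel θ s (b s) ∂μ) t := by
  obtain ⟨F, hF, hFb⟩ := hb.exists_complex_extension
  have ht' : (t : ℂ) ≠ 0 := by exact_mod_cast ht.ne'
  -- With `u z = 1 / (2z)`, the condition `κ < Re u(t)` is exactly `t < T`.
  have h := analyticAt_integral_cexp (κ := 1 / (2 * T)) (μ := μ) (z₀ := t)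
    (u := fun z => 1 / (2 * z)) (v := fun z => F z / z)
    (by convert! hμ using 3; ring) (by fun_prop (disch := simpa using ht'))
    (hF.div analyticAt_id ht') (by
      have : (1 / (2 * (t : ℂ))) = ((1 / (2 * t) : ℝ) : ℂ) := by push_cast; rfl
      rw [this, Complex.ofReal_re]
      exact one_div_lt_one_div_of_lt (by linarith) (by linarith))
  refine h.re_ofReal.congr ?_
  filter_upwards [hFb] with s hs
  rw [← RCLike.re_eq_complex_re]
  have : (fun θ : ℝ => Complex.exp (-(1 / (2 * (s : ℂ))) * θ ^ 2 + F s / s * θ)) =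
      fun θ => ((imageKernel θ s (b s) : ℝ) : ℂ) := by
    ext θ
    rw [hs, imageKernel]
    push_cast
    congr 1
    ring
  rw [this, integral_complex_ofReal]
  simp

/-! ### The kernel along the boundary and its extension to time zero -/

theorem imageKernel_pos (θ t x : ℝ) : 0 < imageKernel θ t x := Real.exp_pos _

theorem continuous_imageKernel (t x : ℝ) : Continuous fun θ => imageKernel θ t x := by
  unfold imageKernel; fun_prop

theorem IsMeasureOn.ae_mem {S : Set ℝ} {ν : Measure ℝ} (h : IsMeasureOn S ν) : ∀ᵐ x ∂ν, x ∈ S :=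
  mem_ae_iff.2 h

/-- The difference quotient of `b` at `0`, completed by the right derivative. -/
noncomputable def slopeAtZero (b : ℝ → ℝ) : ℝ → ℝ :=
  Function.update (slope b 0) 0 (derivWithin b (Ici 0) 0)

/-- The extension of `t ↦ r_θ(t, b(t))` to `t = 0` by continuity. -/
noncomputable def extKernel (b : ℝ → ℝ) (θ t : ℝ) : ℝ :=
  -- The case `θ = 2b(0)` is separate because division by zero would make the first factor `0`
  -- instead of `1`.
  (if θ = 2 * b 0 then 1 else expNegInvGlue (2 * t / (θ * (θ - 2 * b 0)))) *
    Real.exp (θ * slopeAtZero b t)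

section Kernel

variable {b : ℝ → ℝ} {θ t t₀ : ℝ}

theorem IsBoundary.continuousOn_Ioi (hb : IsBoundary b) : ContinuousOn b (Ioi 0) :=
  hb.analytic.continuousOn

theorem IsBoundary.continuousOn (hb : IsBoundary b) : ContinuousOn b (Ici 0) := by
  intro t ht
  rcases eq_or_lt_of_le (mem_Ici.1 ht) with rfl | ht
  · exact hb.slope.continuousWithinAt
  · exact (hb.analytic t ht).continuousAt.continuousWithinAt

theorem IsBoundary.continuousOn_slopeAtZero (hb : IsBoundary b) :
    ContinuousOn (slopeAtZero b) (Ici 0) := by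
  intro t ht
  rcases eq_or_lt_of_le (mem_Ici.1 ht) with rfl | ht
  · have := hasDerivWithinAt_iff_tendsto_slope.1 hb.slope.hasDerivWithinAt
    rw [slopeAtZero, continuousWithinAt_update_same]
    exact this
  · have h : ContinuousAt (_root_.slope b 0) t := by
      have := (hb.analytic t ht).continuousAt
      have ht' : t - 0 ≠ 0 := by simpa using ht.ne'
      unfold _root_.slope
      simp only [vsub_eq_sub, smul_eq_mul]
      fun_prop (disch := assumption)
    exact ((continuousAt_update_of_ne ht.ne').2 h).continuousWithinAt

theorem IsBoundary.exists_slopeAtZero_le (hb : IsBoundary b) (t₀ : ℝ) :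
    ∃ C, 0 ≤ C ∧ ∀ t ∈ Icc 0 t₀, slopeAtZero b t ≤ C := by
  obtain ⟨C, hC⟩ := (isCompact_Icc (a := 0) (b := t₀)).bddAbove_image
    (hb.continuousOn_slopeAtZero.mono Icc_subset_Ici_self)
  exact ⟨max C 0, le_max_right _ _, fun t ht => (hC ⟨t, ht, rfl⟩).trans (le_max_left _ _)⟩

/-- Writing `b(t) = b(0) + t · slope` isolates the part of the exponent singular at `t = 0`. Its
sign explains the threshold `2b(0)`: for `θ ≥ 2b(0)` it is never positive. -/
theorem imageKernel_eq_exp_slopeAtZero (ht : 0 < t) : imageKernel θ t (b t) =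
    Real.exp (-(θ * (θ - 2 * b 0)) / (2 * t) + θ * slopeAtZero b t) := by
  rw [imageKernel, slopeAtZero, Function.update_of_ne ht.ne', slope_def_field, sub_zero]
  congr 1
  field_simp
  ring

theorem extKernel_eq_imageKernel (hb : IsBoundary b) (hθ : 2 * b 0 ≤ θ) (ht : 0 < t) :
    extKernel b θ t = imageKernel θ t (b t) := by
  rw [imageKernel_eq_exp_slopeAtZero ht, extKernel]
  split_ifs with h
  · simp [h]
  · have h1 : 0 < θ - 2 * b 0 := sub_pos.2 (lt_of_le_of_ne hθ (Ne.symm h))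
    have h2 : 0 < θ := by linarith [hb.pos]
    rw [expNegInvGlue, if_neg (not_le.2 (by positivity)), ← Real.exp_add]
    congr 2
    field_simp

/-- This makes an atom at time `0` invisible to every kernel constraint but the one at `θ = 2b(0)`.
-/
theorem extKernel_zero (hθ : 2 * b 0 < θ) : extKernel b θ 0 = 0 := by
  rw [extKernel, if_neg hθ.ne']
  simp

theorem extKernel_nonneg : 0 ≤ extKernel b θ t := by
  unfold extKernel
  split_ifs
  · positivity
  · exact mul_nonneg (expNegInvGlue.nonneg _) (Real.exp_pos _).le

theorem extKernel_zero_left_param : extKernel b (2 * b 0) t =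
    Real.exp (2 * b 0 * slopeAtZero b t) := by
  simp [extKernel]

theorem imageKernel_le_exp (hb : IsBoundary b) (hθ : 2 * b 0 ≤ θ) (ht : 0 < t) :
    imageKernel θ t (b t) ≤ Real.exp (θ * slopeAtZero b t) := by
  rw [imageKernel_eq_exp_slopeAtZero ht]
  apply Real.exp_le_exp.2
  have : 0 ≤ θ * (θ - 2 * b 0) / (2 * t) :=
    div_nonneg (mul_nonneg (by linarith [hb.pos]) (by linarith)) (by positivity)
  rw [neg_div]
  linarith

theorem IsBoundary.continuousOn_extKernel (hb : IsBoundary b) :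
    ContinuousOn (extKernel b θ) (Ici 0) := by
  unfold extKernel
  have h := hb.continuousOn_slopeAtZero
  have h2 := (expNegInvGlue.contDiff (n := 0)).continuous
  split_ifs
  · exact continuousOn_const.mul (h.const_mul _).rexp
  · exact (Continuous.continuousOn (by fun_prop)).mul (h.const_mul _).rexp

theorem IsBoundary.continuousOn_imageKernel (hb : IsBoundary b) :
    ContinuousOn (fun t => imageKernel θ t (b t)) (Ioi 0) := by
  unfold imageKernel
  have := hb.continuousOn_Ioi
  have h1 : ∀ t ∈ Ioi (0 : ℝ), t ≠ 0 := fun t ht => (mem_Ioi.1 ht).ne'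
  have h2 : ∀ t ∈ Ioi (0 : ℝ), 2 * t ≠ 0 := fun t ht => by simpa using h1 t ht
  exact ((continuousOn_const.div (by fun_prop) h2).add
    ((this.const_mul _).div continuousOn_id h1)).rexp

end Kernel

/-! ### Integrals of the kernel against finite time measures -/

section TimeMeasures

variable {b : ℝ → ℝ} {θ t₀ : ℝ} {lam : Measure ℝ}

theorem aestronglyMeasurable_imageKernel (hb : IsBoundary b) (hlam : IsMeasureOn (Ioc 0 t₀) lam) :
    AEStronglyMeasurable (fun t => imageKernel θ t (b t)) lam := by
  have h := (hb.continuousOn_imageKernel (θ := θ)).mono (fun _ h => h.1 : Ioc 0 t₀ ⊆ Ioi 0)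
  simpa [Measure.restrict_eq_self_of_ae_mem hlam.ae_mem] using
    h.aestronglyMeasurable (μ := lam) measurableSet_Ioc

theorem integrable_imageKernel (hb : IsBoundary b) (hlam : IsFiniteMeasureOn (Ioc 0 t₀) lam)
    (hθ : 2 * b 0 ≤ θ) : Integrable (fun t => imageKernel θ t (b t)) lam := by
  have := hlam.1
  obtain ⟨C, hC0, hC⟩ := hb.exists_slopeAtZero_le t₀
  refine Integrable.of_bound (aestronglyMeasurable_imageKernel hb hlam.2) (Real.exp (θ * C)) ?_
  filter_upwards [hlam.2.ae_mem] with t ht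
  rw [Real.norm_of_nonneg (imageKernel_pos _ _ _).le]
  refine (imageKernel_le_exp hb hθ ht.1).trans (Real.exp_le_exp.2 ?_)
  exact mul_le_mul_of_nonneg_left (hC t (Ioc_subset_Icc_self ht)) (by linarith [hb.pos])

theorem timeIntegral_eq_ofReal (hb : IsBoundary b) (hlam : IsFiniteMeasureOn (Ioc 0 t₀) lam)
    (hθ : 2 * b 0 ≤ θ) :
    timeIntegral b lam θ = ENNReal.ofReal (∫ t, imageKernel θ t (b t) ∂lam) :=
  (ofReal_integral_eq_lintegral_ofReal (integrable_imageKernel hb hlam hθ)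
    (Eventually.of_forall fun _ => (imageKernel_pos _ _ _).le)).symm

/-- Dominated convergence, with the slope bounded on `[0, t₀]`. It controls the one parameter at
which an atom at time `0` matters. -/
theorem continuousWithinAt_integral_imageKernel (hb : IsBoundary b)
    (hlam : IsFiniteMeasureOn (Ioc 0 t₀) lam) :
    ContinuousWithinAt (fun θ => ∫ t, imageKernel θ t (b t) ∂lam) (Ici (2 * b 0)) (2 * b 0) := by
  have := hlam.1
  obtain ⟨C, hC0, hC⟩ := hb.exists_slopeAtZero_le t₀
  refine continuousWithinAt_of_dominated (bound := fun _ => Real.exp ((2 * b 0 + 1) * C))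
    (Eventually.of_forall fun θ => aestronglyMeasurable_imageKernel hb hlam.2) ?_
    (integrable_const _)
    (Eventually.of_forall fun t => (continuous_imageKernel t (b t)).continuousWithinAt)
  filter_upwards [self_mem_nhdsWithin,
    mem_nhdsWithin_of_mem_nhds (Iio_mem_nhds (lt_add_one (2 * b 0)))] with θ hθ hθ'
  filter_upwards [hlam.2.ae_mem] with t ht
  rw [Real.norm_of_nonneg (imageKernel_pos _ _ _).le]
  refine (imageKernel_le_exp hb hθ ht.1).trans (Real.exp_le_exp.2 ?_)
  have h1 := hC t (Ioc_subset_Icc_self ht)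
  have h2 : 0 ≤ θ := by linarith [hb.pos, mem_Ici.1 hθ]
  calc θ * slopeAtZero b t ≤ θ * C := by gcongr
    _ ≤ _ := by gcongr; exact (mem_Iio.1 hθ').le

end TimeMeasures

/-! ### Strong duality for the two pairs of programs -/

section Duality

variable {b : ℝ → ℝ} {t₀ x₀ : ℝ}

/-- The discrete measure with weights `w`. -/
noncomputable def discreteMeasure {S : Set ℝ} (w : S →₀ ℝ) : Measure ℝ :=
  ∑ i ∈ w.support, ENNReal.ofReal (w i) • Measure.dirac (i : ℝ)

instance {S : Set ℝ} (w : S →₀ ℝ) : IsFiniteMeasure (discreteMeasure w) :=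
  ⟨by simp [discreteMeasure, ENNReal.sum_lt_top]⟩

theorem isMeasureOn_discreteMeasure {S : Set ℝ} (hS : MeasurableSet S) (w : S →₀ ℝ) :
    IsMeasureOn S (discreteMeasure w) := by
  simp [IsMeasureOn, discreteMeasure, hS.compl]

theorem imageIntegral_discreteMeasure {S : Set ℝ} {w : S →₀ ℝ} (hw : 0 ≤ w) (t x : ℝ) :
    imageIntegral (discreteMeasure w) t x =
      ENNReal.ofReal (w.sum fun i a => a * imageKernel i t x) := by
  rw [imageIntegral, discreteMeasure, lintegral_finsetSum_measure, Finsupp.sum,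
    ENNReal.ofReal_sum_of_nonneg fun i _ => mul_nonneg (hw i) (imageKernel_pos _ _ _).le]
  refine Finset.sum_congr rfl fun i _ => ?_
  rw [lintegral_smul_measure, lintegral_dirac, ENNReal.ofReal_mul (hw i), smul_eq_mul]

theorem imageIntegral_smul (c : ℝ≥0∞) (μ : Measure ℝ) (t x : ℝ) :
    imageIntegral (c • μ) t x = c * imageIntegral μ t x := by
  simp [imageIntegral]

/-- Farkas' lemma for the extended kernels on `[0, t₀]` and one constant function. -/
theorem exists_measure_integral_extKernel_le (hb : IsBoundary b) (σ τ d : ℝ)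
    (hpos : 0 < τ ∨ 0 < σ)
    (H : ∀ (s : ℝ) (w : Ici (2 * b 0) →₀ ℝ), 0 ≤ s → 0 ≤ w →
      (∀ t ∈ Ioc 0 t₀, 0 ≤ s * τ + σ * w.sum fun i a => a * imageKernel i t (b t)) →
      0 ≤ s * d + σ * w.sum fun i a => a * imageKernel i t₀ x₀) :
    ∃ ν : Measure ℝ, IsFiniteMeasureOn (Icc 0 t₀) ν ∧ τ * ν.real univ ≤ d ∧
      ∀ θ ∈ Ici (2 * b 0), σ * ∫ t, extKernel b θ t ∂ν ≤ σ * imageKernel θ t₀ x₀ := by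
  let k : Ici (2 * b 0) → C(Icc 0 t₀, ℝ) := fun θ => ⟨fun t => extKernel b θ t,
    continuousOn_iff_continuous_domRestrict.1 (hb.continuousOn_extKernel.mono Icc_subset_Ici_self)⟩
  -- The index `none` carries the bound on the total mass, `some θ` the kernel constraint. The signs
  -- `(σ, τ) = (-1, 1)` encode `(P₁)` and `(1, -1)` encode `(D₂)`.
  let g : Option (Ici (2 * b 0)) → C(Icc 0 t₀, ℝ) :=
    fun o => o.elim (ContinuousMap.const _ τ) fun θ => σ • k θ
  let e : Option (Ici (2 * b 0)) → ℝ := fun o => o.elim d fun θ => σ * imageKernel θ t₀ x₀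
  -- When the constant is negative, only the kernel at `θ = 2b(0)` is available, being the one that
  -- stays positive at time `0`.
  obtain ⟨i₀, hi₀⟩ : ∃ i₀, ∀ x, 0 < g i₀ x := by
    rcases hpos with h | h
    · exact ⟨none, fun x => h⟩
    · refine ⟨some ⟨2 * b 0, self_mem_Ici⟩, fun x => ?_⟩
      change 0 < σ * extKernel b (2 * b 0) x
      rw [extKernel_zero_left_param]
      positivity
  obtain ⟨ν, hν, hνg⟩ := exists_measure_integral_le g e i₀ hi₀ (by
    intro w hw hwg
    have hsome : 0 ≤ w.some := fun i => hw (some i)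
    have hsum : (w.some.sum fun i a => a * (σ * imageKernel i t₀ x₀)) =
        σ * w.some.sum fun i a => a * imageKernel i t₀ x₀ := by
      rw [Finsupp.mul_sum]; congr 1; ext i a; ring
    rw [Finsupp.sum_option_index _ _ (by simp) (by intros; ring)]
    change 0 ≤ w none * d + w.some.sum fun i a => a * (σ * imageKernel i t₀ x₀)
    rw [hsum]
    refine H _ _ (hw none) hsome fun t ht => ?_
    have h := hwg ⟨t, Ioc_subset_Icc_self ht⟩
    rw [Finsupp.sum_option_index _ _ (by simp) (by intros; ring)] at h
    change 0 ≤ w none * τ + w.some.sum fun i a => a * (σ * extKernel b i t) at h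
    rw [Finsupp.mul_sum]
    convert h using 2
    refine Finsupp.sum_congr fun i _ => ?_
    rw [extKernel_eq_imageKernel hb i.2 ht.1]
    ring)
  have hemb : MeasurableEmbedding (Subtype.val : Icc (0 : ℝ) t₀ → ℝ) :=
    MeasurableEmbedding.subtype_coe measurableSet_Icc
  refine ⟨ν.map Subtype.val, ⟨inferInstance, ?_⟩, ?_, fun θ hθ => ?_⟩
  · rw [IsMeasureOn, hemb.map_apply]
    simp
  · have h := hνg none
    change ∫ _, τ ∂ν ≤ d at h
    rw [integral_const, smul_eq_mul, mul_comm] at h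
    rwa [map_measureReal_apply measurable_subtype_coe MeasurableSet.univ, preimage_univ]
  · rw [hemb.integral_map, ← integral_const_mul]
    exact hνg (some ⟨θ, hθ⟩)

theorem integral_extKernel_eq (hb : IsBoundary b) (ht₀ : 0 < t₀) {ν : Measure ℝ}
    (hν : IsFiniteMeasureOn (Icc 0 t₀) ν) {θ : ℝ} (hθ : 2 * b 0 ≤ θ) :
    ∫ t, extKernel b θ t ∂ν = ν.real {0} * extKernel b θ 0 +
      ∫ t, imageKernel θ t (b t) ∂(ν.restrict (Ioc 0 t₀)) := by
  have := hν.1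
  have hint : IntegrableOn (extKernel b θ) (Icc 0 t₀) ν :=
    (hb.continuousOn_extKernel.mono Icc_subset_Ici_self).integrableOn_compact isCompact_Icc
  have hunion : Icc 0 t₀ = {0} ∪ Ioc 0 t₀ := by
    rw [singleton_union, Ioc_insert_left ht₀.le]
  rw [hunion] at hint
  conv_lhs => rw [← Measure.restrict_eq_self_of_ae_mem hν.2.ae_mem, hunion]
  rw [setIntegral_union (by simp) measurableSet_Ioc hint.left_of_union hint.right_of_union,
    integral_singleton, smul_eq_mul]
  congr 1
  exact setIntegral_congr_fun measurableSet_Ioc fun t ht => extKernel_eq_imageKernel hb hθ ht.1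

theorem IsMeasureOn.smul {S : Set ℝ} {ν : Measure ℝ} (h : IsMeasureOn S ν) (c : ℝ≥0∞) :
    IsMeasureOn S (c • ν) := by
  rw [IsMeasureOn] at h ⊢
  rw [Measure.smul_apply, h, smul_zero]

theorem isFiniteMeasureOn_restrict {ν : Measure ℝ} [IsFiniteMeasure ν] {S : Set ℝ}
    (hS : MeasurableSet S) : IsFiniteMeasureOn S (ν.restrict S) :=
  ⟨inferInstance, by simp [IsMeasureOn, Measure.restrict_apply hS.compl]⟩

/-- Strong duality for `(P₁)` and `(D₁)`: a bound for `(D₁)` over finite measures is the mass of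
an admissible measure of `(P₁)`. -/
theorem exists_p1Admissible_le (hb : IsBoundary b) (ht₀ : 0 < t₀) {v : ℝ} (hv₀ : 0 ≤ v)
    (hv : ∀ μ : Measure ℝ, IsFiniteMeasure μ → D1Admissible b t₀ μ →
      imageIntegral μ t₀ x₀ ≤ ENNReal.ofReal v) :
    ∃ lam, P1Admissible b t₀ x₀ (Ioc 0 t₀) lam ∧ lam univ ≤ ENNReal.ofReal v := by
  obtain ⟨ν, hν, hmass, hker⟩ := exists_measure_integral_extKernel_le (t₀ := t₀) (x₀ := x₀) hb
    (-1) 1 v (Or.inl one_pos) (by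
    intro s w hs hw h
    -- Normalising the weights by `s` would fail for `s = 0`, so `s + η` is used and `η` tends to
    -- `0`.
    suffices ∀ η > 0, (w.sum fun i a => a * imageKernel i t₀ x₀) ≤ v * (s + η) by
      suffices (w.sum fun i a => a * imageKernel i t₀ x₀) ≤ s * v by linarith
      refine le_of_forall_pos_le_add fun ε hε => (this (ε / (v + 1)) (by positivity)).trans ?_
      have : v * (ε / (v + 1)) ≤ ε := by
        rw [← mul_div_assoc, div_le_iff₀ (by positivity)]
        nlinarith
      linarith
    intro η hη
    have hs' : 0 < s + η := by linarith
    have h1 := hv (ENNReal.ofReal (s + η)⁻¹ • discreteMeasure w)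
      (Measure.smul_finite _ ENNReal.ofReal_ne_top) ⟨
        (isMeasureOn_discreteMeasure measurableSet_Ici w).smul _, fun t ht => by
        rw [imageIntegral_smul, imageIntegral_discreteMeasure hw,
          ← ENNReal.ofReal_mul (by positivity), ENNReal.ofReal_le_one, inv_mul_le_iff₀ hs']
        linarith [h t ht]⟩
    rw [imageIntegral_smul, imageIntegral_discreteMeasure hw,
      ← ENNReal.ofReal_mul (by positivity), ENNReal.ofReal_le_ofReal_iff hv₀,
      inv_mul_le_iff₀ hs'] at h1
    linarith)
  have := hν.1
  have hfin := isFiniteMeasureOn_restrict (ν := ν) (measurableSet_Ioc (a := 0) (b := t₀))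
  have hgt : ∀ θ ∈ Ioi (2 * b 0),
      imageKernel θ t₀ x₀ ≤ ∫ t, imageKernel θ t (b t) ∂(ν.restrict (Ioc 0 t₀)) := by
    intro θ hθ
    have h := hker θ (Ioi_subset_Ici_self hθ)
    rw [integral_extKernel_eq hb ht₀ hν (mem_Ioi.1 hθ).le, extKernel_zero hθ] at h
    linarith
  refine ⟨ν.restrict (Ioc 0 t₀), ⟨hfin, fun θ hθ => ?_⟩, ?_⟩
  · rw [timeIntegral_eq_ofReal hb hfin hθ]
    apply ENNReal.ofReal_le_ofReal
    -- At `θ = 2b(0)` the atom at time `0` may have been needed; the constraint without it follows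
    -- by letting `θ` decrease to `2b(0)`.
    rcases eq_or_lt_of_le (mem_Ici.1 hθ) with rfl | hθ
    · exact le_of_tendsto_of_tendsto
        ((continuous_imageKernel t₀ x₀).continuousWithinAt (s := Ioi (2 * b 0)))
        ((continuousWithinAt_integral_imageKernel hb hfin).mono Ioi_subset_Ici_self)
        (eventually_mem_nhdsWithin.mono hgt)
    · exact hgt θ hθ
  · refine (Measure.restrict_apply_le _ _).trans ?_
    rw [← ofReal_measureReal]
    exact ENNReal.ofReal_le_ofReal (by linarith)

/-- Away from the left endpoint `θ = 2b(0)`, the kernel at a small time is negligible against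
the kernel at `(t₀, x₀)`. -/
theorem eventually_mul_imageKernel_le (hb : IsBoundary b) (ht₀ : 0 < t₀) {a η u : ℝ} (ha : 0 ≤ a)
    (hη : 0 < η) (hu : 2 * b 0 < u) :
    ∀ᶠ ε in 𝓝[>] (0 : ℝ), ∀ θ, u ≤ θ → a * imageKernel θ ε (b ε) ≤ η * imageKernel θ t₀ x₀ := by
  obtain ⟨C, hC0, hC⟩ := hb.exists_slopeAtZero_le t₀
  have hb0 := hb.pos
  have hu0 : 0 < u := by linarith
  -- Chosen so that `2b(0) N = a / η`; then `exp y ≥ y` gives `a exp(-2b(0)N) ≤ η`.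
  set N := a / η / (2 * b 0)
  have hN : 0 ≤ N := by positivity
  have haN : a * Real.exp (-(2 * b 0 * N)) ≤ η := by
    have : 2 * b 0 * N = a / η := by simp only [N]; field_simp
    rw [this, Real.exp_neg, ← div_eq_mul_inv, div_le_iff₀ (Real.exp_pos _)]
    have := Real.add_one_le_exp (a / η)
    calc a = η * (a / η) := by field_simp
      _ ≤ _ := by gcongr; linarith
  set κ := (u - 2 * b 0) / u
  have hκ : 0 < κ := div_pos (by linarith) hu0
  set Q := C + |x₀| / t₀ + N
  have hQ : 0 ≤ Q := by positivity
  -- For `θ ≥ u` the linear terms are at most `θ² Q / u` and `θ - 2b(0) ≥ κθ`. Everything is thus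
  -- compared with `θ²`, and one `ε` serves all `θ`.
  have hlarge := (tendsto_inv_nhdsGT_zero (𝕜 := ℝ).const_mul_atTop hκ).eventually_ge_atTop
    (2 * (1 / (2 * t₀) + Q / u))
  filter_upwards [hlarge, self_mem_nhdsWithin, mem_nhdsWithin_of_mem_nhds (Iio_mem_nhds ht₀)]
    with ε h1 hε hε' θ hθ
  have hε : 0 < ε := hε
  have hθ0 : 0 < θ := hu0.trans_le hθ
  have key : imageKernel θ ε (b ε) ≤ Real.exp (-(2 * b 0 * N)) * imageKernel θ t₀ x₀ := by
    rw [imageKernel_eq_exp_slopeAtZero hε, imageKernel, ← Real.exp_add]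
    apply Real.exp_le_exp.2
    have e1 : slopeAtZero b ε ≤ C := hC ε ⟨hε.le, (mem_Iio.1 hε').le⟩
    have e2 : κ * θ ≤ θ - 2 * b 0 := by
      simp only [κ]
      rw [div_mul_eq_mul_div, div_le_iff₀ hu0]
      nlinarith
    have e3 : θ * Q ≤ θ * θ * (Q / u) := by
      have : Q = u * (Q / u) := by field_simp
      calc θ * Q = θ * (u * (Q / u)) := by rw [← this]
        _ ≤ θ * (θ * (Q / u)) := by gcongr
        _ = _ := by ring
    have e4 : θ * θ * (1 / (2 * t₀)) + θ * Q ≤ θ * (θ - 2 * b 0) / (2 * ε) := by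
      calc _ ≤ θ * θ * (1 / (2 * t₀) + Q / u) := by linarith
        _ ≤ θ * θ * (κ * ε⁻¹ / 2) := by gcongr; linarith
        _ = θ * (κ * θ) / (2 * ε) := by field_simp
        _ ≤ _ := by gcongr
    have e5 : -(θ * (|x₀| / t₀)) ≤ θ * x₀ / t₀ := by
      rw [mul_div_assoc, ← mul_neg, ← neg_div]
      gcongr
      exact neg_abs_le x₀
    have e6 : θ * slopeAtZero b ε ≤ θ * C := by gcongr
    have e7 : 2 * b 0 * N ≤ θ * N := by gcongr; linarith
    have e8 : -θ ^ 2 / (2 * t₀) = -(θ * θ * (1 / (2 * t₀))) := by ring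
    have e9 : θ * Q = θ * C + θ * (|x₀| / t₀) + θ * N := by simp only [Q]; ring
    rw [neg_div, e8]
    linarith
  calc a * imageKernel θ ε (b ε) ≤ a * (Real.exp (-(2 * b 0 * N)) * imageKernel θ t₀ x₀) := by
        gcongr
    _ = (a * Real.exp (-(2 * b 0 * N))) * imageKernel θ t₀ x₀ := by ring
    _ ≤ _ := mul_le_mul_of_nonneg_right haN (imageKernel_pos _ _ _).le

/-- Strong duality for `(P₂)` and `(D₂)`: a lower bound for `(P₂)` over finite measures is
approximated by the masses of admissible measures of `(D₂)`. -/
theorem exists_d2Admissible_ge (hb : IsBoundary b) (ht₀ : 0 < t₀) {m : ℝ}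
    (hm : ∀ μ : Measure ℝ, IsFiniteMeasure μ → P2Admissible b t₀ μ →
      ENNReal.ofReal m ≤ imageIntegral μ t₀ x₀) {η : ℝ} (hη : 0 < η) (hη1 : η < 1) :
    ∃ lam, D2Admissible b t₀ x₀ (Ioc 0 t₀) lam ∧ ENNReal.ofReal ((1 - η) * m) ≤ lam univ := by
  obtain ⟨ν, hν, hmass, hker⟩ := exists_measure_integral_extKernel_le (t₀ := t₀) (x₀ := x₀) hb
    1 (-1) (-m) (Or.inr one_pos) (by
    intro s w hs hw h
    have hnonneg : 0 ≤ w.sum fun i a => a * imageKernel i t₀ x₀ :=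
      Finset.sum_nonneg fun i _ => mul_nonneg (hw i) (imageKernel_pos _ _ _).le
    rcases hs.eq_or_lt with rfl | hs
    · simpa using hnonneg
    have h1 := hm (ENNReal.ofReal s⁻¹ • discreteMeasure w)
      (Measure.smul_finite _ ENNReal.ofReal_ne_top) ⟨
        (isMeasureOn_discreteMeasure measurableSet_Ici w).smul _, fun t ht => by
        rw [imageIntegral_smul, imageIntegral_discreteMeasure hw,
          ← ENNReal.ofReal_mul (by positivity), ENNReal.one_le_ofReal, le_inv_mul_iff₀ hs]
        linarith [h t ht]⟩
    rw [imageIntegral_smul, imageIntegral_discreteMeasure hw,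
      ← ENNReal.ofReal_mul (by positivity), ENNReal.ofReal_le_ofReal_iff (by positivity),
      le_inv_mul_iff₀ hs] at h1
    linarith)
  have := hν.1
  set ν' := ν.restrict (Ioc 0 t₀) with hν'
  have hfin : IsFiniteMeasureOn (Ioc 0 t₀) ν' := isFiniteMeasureOn_restrict measurableSet_Ioc
  set a := ν.real {0}
  have ha : 0 ≤ a := measureReal_nonneg
  set ψ : ℝ → ℝ := fun θ => ∫ t, imageKernel θ t (b t) ∂ν' with hψ
  have hext : ∀ θ, 2 * b 0 ≤ θ → a * extKernel b θ 0 + ψ θ ≤ imageKernel θ t₀ x₀ := by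
    intro θ hθ
    have h := hker θ hθ
    rwa [integral_extKernel_eq hb ht₀ hν hθ, one_mul, one_mul] at h
  have hψle : ∀ θ, 2 * b 0 ≤ θ → ψ θ ≤ imageKernel θ t₀ x₀ := fun θ hθ => by
    linarith [hext θ hθ, mul_nonneg ha (extKernel_nonneg (b := b) (θ := θ) (t := 0))]
  have hψ0 : ∀ θ, 0 ≤ ψ θ := fun θ => integral_nonneg fun t => (imageKernel_pos _ _ _).le
  -- A lower bound for the slack at `θ = p.1` after moving the atom to time `p.2` and scaling by `1
  -- - η`. The moved kernel is replaced by its upper bound `exp (θ · slope)`, which is jointly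
  -- continuous at the corner `(2b(0), 0)`; there the factor `1 - η` makes the slack strictly
  -- positive.
  let Φ : ℝ × ℝ → ℝ := fun p => imageKernel p.1 t₀ x₀ -
    (1 - η) * (a * Real.exp (p.1 * slopeAtZero b p.2) + ψ p.1)
  have hΦc : ContinuousWithinAt Φ (Ici (2 * b 0) ×ˢ Ici 0) (2 * b 0, 0) := by
    have c1 : ContinuousWithinAt (fun p : ℝ × ℝ => ψ p.1) (Ici (2 * b 0) ×ˢ Ici 0)
        (2 * b 0, 0) :=
      ContinuousWithinAt.comp (g := ψ) (t := Ici (2 * b 0)) (x := ((2 * b 0, 0) : ℝ × ℝ))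
        (continuousWithinAt_integral_imageKernel hb hfin) continuous_fst.continuousWithinAt fun p hp => hp.1
    have c2 : ContinuousWithinAt (fun p : ℝ × ℝ => slopeAtZero b p.2) (Ici (2 * b 0) ×ˢ Ici 0)
        (2 * b 0, 0) :=
      (hb.continuousOn_slopeAtZero 0 self_mem_Ici).comp (x := ((2 * b 0, 0) : ℝ × ℝ))
        continuous_snd.continuousWithinAt fun p hp => hp.2
    have c3 : ContinuousWithinAt (fun p : ℝ × ℝ => imageKernel p.1 t₀ x₀)
        (Ici (2 * b 0) ×ˢ Ici 0) (2 * b 0, 0) :=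
      ((continuous_imageKernel t₀ x₀).comp continuous_fst).continuousWithinAt
    exact c3.sub (((((continuous_fst.continuousWithinAt.mul c2).rexp).const_mul a).add
      c1).const_mul (1 - η))
  have hΦ0 : 0 < Φ (2 * b 0, 0) := by
    have h := hext (2 * b 0) le_rfl
    rw [extKernel_zero_left_param] at h
    have h2 := imageKernel_pos (2 * b 0) t₀ x₀
    simp only [Φ]
    nlinarith
  have hev := hΦc.eventually (lt_mem_nhds hΦ0)
  rw [nhdsWithin_prod_eq] at hev
  obtain ⟨pa, hpa, pb, hpb, hab⟩ := eventually_prod_iff.1 hev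
  obtain ⟨u, hu, hu2⟩ := (mem_nhdsGE_iff_exists_Ico_subset).1 hpa
  obtain ⟨ε, ⟨hfar, hpε⟩, hε0, hεt⟩ := (((eventually_mul_imageKernel_le (x₀ := x₀) hb ht₀ ha hη
    (mem_Ioi.1 hu)).and (hpb.filter_mono (nhdsWithin_mono _ Ioi_subset_Ici_self))).and
    (Ioo_mem_nhdsGT ht₀)).exists
  have hmain : ∀ θ, 2 * b 0 ≤ θ →
      (1 - η) * (ψ θ + a * imageKernel θ ε (b ε)) ≤ imageKernel θ t₀ x₀ := by
    intro θ hθ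
    have hK := imageKernel_pos θ ε (b ε)
    rcases lt_or_ge θ u with h | h
    · have h1 : 0 < Φ (θ, ε) := hab (hu2 ⟨hθ, h⟩) hpε
      simp only [Φ] at h1
      have h2 : a * imageKernel θ ε (b ε) ≤ a * Real.exp (θ * slopeAtZero b ε) :=
        mul_le_mul_of_nonneg_left (imageKernel_le_exp hb hθ hε0) ha
      nlinarith
    -- Away from the endpoint the moved atom costs at most `η` times the right side, and `(1 - η)(1
    -- + η) ≤ 1`.
    · have h1 := hfar θ h
      have h2 := hψle θ hθ
      have h3 := mul_nonneg ha hK.le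
      nlinarith
  have h1η : 0 ≤ 1 - η := by linarith
  refine ⟨ENNReal.ofReal (1 - η) • (ν' + ENNReal.ofReal a • Measure.dirac ε),
    ⟨⟨?_, ?_⟩, fun θ hθ => ?_⟩, ?_⟩
  · have : IsFiniteMeasure (ENNReal.ofReal a • Measure.dirac ε) :=
      Measure.smul_finite _ ENNReal.ofReal_ne_top
    exact Measure.smul_finite _ ENNReal.ofReal_ne_top
  · have h1 : ν' (Ioc 0 t₀)ᶜ = 0 := hfin.2
    have h2 : ε ∈ Ioc 0 t₀ := ⟨hε0, hεt.le⟩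
    simp [IsMeasureOn, h1, measurableSet_Ioc.compl, h2.1, h2.2]
  · have h := timeIntegral_eq_ofReal hb hfin hθ
    rw [timeIntegral] at h ⊢
    rw [lintegral_smul_measure, lintegral_add_measure, lintegral_smul_measure, lintegral_dirac, h,
      smul_eq_mul, smul_eq_mul, ← ENNReal.ofReal_mul ha, ← ENNReal.ofReal_add (hψ0 θ)
        (mul_nonneg ha (imageKernel_pos _ _ _).le), ← ENNReal.ofReal_mul h1η]
    exact ENNReal.ofReal_le_ofReal (hmain θ hθ)
  · have htot : ν' univ + ENNReal.ofReal a = ν univ := by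
      have h1 : ν univ = ν ({0} ∪ Ioc 0 t₀) := by
        rw [singleton_union, Ioc_insert_left ht₀.le]
        refine (measure_eq_measure_of_null_sdiff (subset_univ _) ?_).symm
        rw [← compl_eq_univ_sdiff]
        exact hν.2
      rw [h1, measure_union (by simp) measurableSet_Ioc, add_comm, ofReal_measureReal, hν',
        Measure.restrict_apply_univ]
    simp only [Measure.smul_apply, Measure.add_apply, measure_univ, smul_eq_mul, mul_one, htot]
    rw [← ofReal_measureReal (μ := ν), ← ENNReal.ofReal_mul h1η]
    exact ENNReal.ofReal_le_ofReal (mul_le_mul_of_nonneg_left (by linarith) h1η)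

end Duality

end ImagesLP

/-- Weighting by `f` gives a finite measure, and the finite density `1 / f` recovers `μ`. Optimisers
may have infinite mass, so their σ-finiteness comes from the Gaussian moment. -/
theorem MeasureTheory.sigmaFinite_of_lintegral_ofReal_lt_top {α : Type*} [MeasurableSpace α]
    {μ : Measure α} {f : α → ℝ} (hf : Measurable f) (hpos : ∀ x, 0 < f x)
    (h : ∫⁻ x, ENNReal.ofReal (f x) ∂μ < ∞) : SigmaFinite μ := by
  have hfin : IsFiniteMeasure (μ.withDensity fun x => ENNReal.ofReal (f x)) :=
    isFiniteMeasure_withDensity h.ne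
  have h1 := withDensity_inv_same (μ := μ) (f := fun x => ENNReal.ofReal (f x)) hf.ennreal_ofReal
    (Eventually.of_forall fun x => by simpa using hpos x)
    (Eventually.of_forall fun x => ENNReal.ofReal_ne_top)
  rw [← h1]
  have h2 : (fun x => (ENNReal.ofReal (f x))⁻¹) =
      fun x => (((f x)⁻¹.toNNReal : NNReal) : ℝ≥0∞) := by
    ext x
    rw [← ENNReal.ofReal_inv_of_pos (hpos x)]
    rfl
  rw [h2]
  exact SigmaFinite.withDensity _

namespace ImagesLP

/-! ### Tonelli's theorem for the pairing -/

section Slackness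

variable {b : ℝ → ℝ} {t₀ : ℝ} {lam μ : Measure ℝ}

theorem aemeasurable_uncurry_imageKernel (hb : IsBoundary b) (hlam : IsMeasureOn (Ioc 0 t₀) lam)
    [SFinite μ] :
    AEMeasurable (fun p : ℝ × ℝ => ENNReal.ofReal (imageKernel p.2 p.1 (b p.1)))
      (lam.prod μ) := by
  have hbm : AEMeasurable b lam := by
    have h := hb.continuousOn_Ioi.mono (fun _ h => h.1 : Ioc 0 t₀ ⊆ Ioi 0)
    simpa [Measure.restrict_eq_self_of_ae_mem hlam.ae_mem] using
      h.aemeasurable (μ := lam) measurableSet_Ioc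
  have h1 : AEMeasurable (fun p : ℝ × ℝ => b p.1) (lam.prod μ) :=
    hbm.comp_quasiMeasurePreserving Measure.quasiMeasurePreserving_fst
  unfold imageKernel
  fun_prop

theorem lintegral_imageIntegral (hb : IsBoundary b) (hlam : IsFiniteMeasureOn (Ioc 0 t₀) lam)
    [SFinite μ] :
    ∫⁻ t, imageIntegral μ t (b t) ∂lam = ∫⁻ θ, timeIntegral b lam θ ∂μ := by
  have := hlam.1
  exact lintegral_lintegral_swap (aemeasurable_uncurry_imageKernel hb hlam.2)

end Slackness

/-! ### Mass of the time measures near the final time -/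

section Support

variable {b : ℝ → ℝ} {t₀ x₀ : ℝ} {lam : Measure ℝ}

/-- A measure living on `(0, s]` has a time integral decaying like `exp(-θ² / (2s))` up to factors
exponential in `θ`, too fast to dominate `r_θ(t₀, x₀)` as `θ → ∞`. -/
theorem P1Admissible.measure_Ioc_ne_zero (hb : IsBoundary b)
    (hlam : P1Admissible b t₀ x₀ (Ioc 0 t₀) lam) {s : ℝ} (hs : s ∈ Ioo 0 t₀) :
    lam (Ioc s t₀) ≠ 0 := by
  intro h0
  have := hlam.1.1
  obtain ⟨hs0, hst⟩ := hs
  have ht₀ : 0 < t₀ := hs0.trans hst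
  obtain ⟨M, hM⟩ := (isCompact_Icc (a := 0) (b := t₀)).bddAbove_image
    (hb.continuousOn.mono Icc_subset_Ici_self)
  have hae : ∀ᵐ t ∂lam, t ∈ Ioc 0 s := by
    have h1 : ∀ᵐ t ∂lam, t ∉ Ioc s t₀ := measure_eq_zero_iff_ae_notMem.1 h0
    filter_upwards [hlam.1.2.ae_mem, h1] with t ht ht'
    exact ⟨ht.1, not_lt.1 fun h => ht' ⟨h, ht.2⟩⟩
  set L := lam.real univ
  set α := 1 / (2 * s) - 1 / (2 * t₀)
  have hα : 0 < α := sub_pos.2 (one_div_lt_one_div_of_lt (by linarith) (by linarith))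
  set β := x₀ / t₀ - M / s
  -- `2M` makes the bound monotone in `t`, `(1 - β) / α` gives `αθ + β ≥ 1`, and `L` then forces
  -- `exp(θ(αθ + β)) ≥ 1 + L`.
  set θ := max (max (2 * b 0) (2 * M)) (max ((1 - β) / α) L)
  have hθ1 : 2 * b 0 ≤ θ := (le_max_left _ _).trans (le_max_left _ _)
  have hθ2 : 2 * M ≤ θ := (le_max_right _ _).trans (le_max_left _ _)
  have hθ3 : (1 - β) / α ≤ θ := (le_max_left _ _).trans (le_max_right _ _)
  have hθ4 : L ≤ θ := (le_max_right _ _).trans (le_max_right _ _)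
  have hθ0 : 0 ≤ θ := by linarith [hb.pos]
  have hadm := hlam.2 θ hθ1
  have hle : ∫ t, imageKernel θ t (b t) ∂lam ≤ L * Real.exp (-(θ * (θ - 2 * M)) / (2 * s)) := by
    have h1 : ∫ t, imageKernel θ t (b t) ∂lam ≤
        ∫ _, Real.exp (-(θ * (θ - 2 * M)) / (2 * s)) ∂lam := by
      refine integral_mono_ae (integrable_imageKernel hb hlam.1 hθ1) (integrable_const _) ?_
      filter_upwards [hae] with t ht
      apply Real.exp_le_exp.2
      have hbt : b t ≤ M := hM ⟨t, ⟨ht.1.le, ht.2.trans hst.le⟩, rfl⟩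
      have ht0 : 0 < t := ht.1
      calc -θ ^ 2 / (2 * t) + θ * b t / t = -(θ * (θ - 2 * b t) / (2 * t)) := by field_simp; ring
        _ ≤ -(θ * (θ - 2 * M) / (2 * t)) := by gcongr
        _ ≤ -(θ * (θ - 2 * M) / (2 * s)) := by
            have : 0 ≤ θ * (θ - 2 * M) := mul_nonneg hθ0 (by linarith)
            gcongr
            exact ht.2
        _ = _ := by rw [neg_div]
    simpa [integral_const] using h1
  rw [timeIntegral_eq_ofReal hb hlam.1 hθ1, ENNReal.ofReal_le_ofReal_iff
    (integral_nonneg fun t => (imageKernel_pos _ _ _).le)] at hadm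
  have h2 := hadm.trans hle
  rw [imageKernel, ← div_le_iff₀ (Real.exp_pos _), ← Real.exp_sub] at h2
  have h3 : -θ ^ 2 / (2 * t₀) + θ * x₀ / t₀ - -(θ * (θ - 2 * M)) / (2 * s) =
      θ * (α * θ + β) := by
    simp only [α, β]; field_simp; ring
  rw [h3] at h2
  have h4 : 1 ≤ α * θ + β := by
    rw [div_le_iff₀ hα] at hθ3
    linarith
  have h5 : θ ≤ θ * (α * θ + β) := le_mul_of_one_le_right hθ0 h4
  linarith [Real.add_one_le_exp (θ * (α * θ + β))]

/-- An atom of mass `l` would need `l exp(θ(b(t₀) - x₀) / t₀) ≤ 1` for all `θ ≥ 2b(0)`, impossible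
for large `θ` as `x₀ < b(t₀)`. -/
theorem D2Admissible.measure_singleton_eq_zero (ht₀ : 0 < t₀)
    (hx₀ : x₀ < b t₀) (hlam : D2Admissible b t₀ x₀ (Ioc 0 t₀) lam) : lam {t₀} = 0 := by
  have := hlam.1.1
  by_contra hne
  set l := lam.real {t₀}
  have hl : 0 < l := ENNReal.toReal_pos hne (measure_ne_top _ _)
  have hd : 0 < b t₀ - x₀ := sub_pos.2 hx₀
  set θ := max (2 * b 0) (t₀ / ((b t₀ - x₀) * l))
  have h1 : ENNReal.ofReal (imageKernel θ t₀ (b t₀)) * lam {t₀} ≤ timeIntegral b lam θ := by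
    rw [← lintegral_singleton (fun t => ENNReal.ofReal (imageKernel θ t (b t)))]
    exact setLIntegral_le_lintegral _ _
  have h2 := h1.trans (hlam.2 θ (mem_Ici.2 (le_max_left _ _)))
  rw [← ofReal_measureReal, ← ENNReal.ofReal_mul (imageKernel_pos _ _ _).le,
    ENNReal.ofReal_le_ofReal_iff (imageKernel_pos _ _ _).le] at h2
  have h3 : imageKernel θ t₀ (b t₀) =
      imageKernel θ t₀ x₀ * Real.exp (θ * (b t₀ - x₀) / t₀) := by
    rw [imageKernel, imageKernel, ← Real.exp_add]
    congr 1
    ring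
  rw [h3, mul_assoc, mul_le_iff_le_one_right (imageKernel_pos _ _ _)] at h2
  have h4 : 1 / l ≤ θ * (b t₀ - x₀) / t₀ := by
    have : t₀ / ((b t₀ - x₀) * l) ≤ θ := le_max_right _ _
    calc 1 / l = t₀ / ((b t₀ - x₀) * l) * (b t₀ - x₀) / t₀ := by field_simp
      _ ≤ _ := by gcongr
  have h5 : (1 / l + 1) * l ≤ Real.exp (θ * (b t₀ - x₀) / t₀) * l := by
    gcongr
    linarith [Real.add_one_le_exp (θ * (b t₀ - x₀) / t₀)]
  have h6 : (1 / l + 1) * l = 1 + l := by field_simp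
  change Real.exp (θ * (b t₀ - x₀) / t₀) * l ≤ 1 at h2
  linarith

end Support

/-! ### Analytic continuation, complementary slackness and conclusion -/

/-- If `r_μ(t, b(t)) = 1` for almost all `t` under a measure that charges each left
neighbourhood of `t₀`, then `μ` represents `b` up to `t₀`. -/
theorem representableUpTo_of_ae_eq_one {b : ℝ → ℝ} {t₀ T : ℝ} {lam μ : Measure ℝ}
    (hb : IsBoundary b) (ht₀ : 0 < t₀) (hT : t₀ < T) [SigmaFinite μ] (hμ0 : IsMeasureOn (Ioi 0) μ)
    (hμ : ∫⁻ θ, ENNReal.ofReal (Real.exp (-θ ^ 2 / (2 * T))) ∂μ < ∞)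
    (hone : ∀ᵐ t ∂lam, imageIntegral μ t (b t) = 1)
    (hlam : ∀ s ∈ Ioo 0 t₀, lam (Ioo s t₀) ≠ 0) : RepresentableUpTo b t₀ := by
  refine ⟨μ, inferInstance, hμ0, ?_⟩
  have hint : Integrable (fun θ : ℝ => Real.exp (-θ ^ 2 / (2 * T))) μ :=
    (lintegral_ofReal_ne_top_iff_integrable
      (Continuous.aestronglyMeasurable (by fun_prop))
      (Eventually.of_forall fun θ => (Real.exp_pos _).le)).1 hμ.ne
  have hbochner (t : ℝ) :
      ∫ θ, imageKernel θ t (b t) ∂μ = (imageIntegral μ t (b t)).toReal :=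
    integral_eq_lintegral_of_nonneg_ae (Eventually.of_forall fun θ => (imageKernel_pos _ _ _).le)
      (continuous_imageKernel _ _).aestronglyMeasurable
  have hana : AnalyticOnNhd ℝ (fun t => ∫ θ, imageKernel θ t (b t) ∂μ) (Ioo 0 T) := fun t ht =>
    analyticAt_integral_imageKernel ht.1 ht.2 (hb.analytic t ht.1) hint
  have hfreq : ∃ᶠ t in 𝓝[≠] t₀, ∫ θ, imageKernel θ t (b t) ∂μ = 1 := by
    have h : ∃ᶠ t in 𝓝[<] t₀, ∫ θ, imageKernel θ t (b t) ∂μ = 1 := by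
      rw [Filter.frequently_iff]
      intro U hU
      obtain ⟨l, hl, hlU⟩ := (mem_nhdsLT_iff_exists_mem_Ico_Ioo_subset ht₀).1 hU
      have hpos : lam (Ioo (max l (t₀ / 2)) t₀) ≠ 0 := hlam _
        ⟨lt_max_of_lt_right (by linarith), max_lt hl.2 (by linarith)⟩
      obtain ⟨t, ht, ht1⟩ := (frequently_ae_mem_iff.2 hpos).and_eventually hone |>.exists
      refine ⟨t, hlU ⟨(le_max_left _ _).trans_lt ht.1, ht.2⟩, ?_⟩
      rw [hbochner, ht1, ENNReal.toReal_one]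
    exact h.filter_mono (nhdsWithin_mono _ fun t ht => (mem_Iio.1 ht).ne)
  have heq := hana.eqOn_of_preconnected_of_frequently_eq analyticOnNhd_const
    isPreconnected_Ioo ⟨ht₀, hT⟩ hfreq
  intro t ht
  have h : ∫ θ, imageKernel θ t (b t) ∂μ = 1 := heq ⟨ht.1, ht.2.trans_lt hT⟩
  rw [hbochner] at h
  -- An infinite integral would have `toReal` equal to `0`, so the value `1` also certifies
  -- finiteness.
  exact (ENNReal.toReal_eq_one_iff _).1 h

/-- Complementary slackness for `(D₁)` and `(P₁)`. -/
theorem d1Optimal_ae_eq_one {b : ℝ → ℝ} {t₀ x₀ : ℝ} {μ lam : Measure ℝ}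
    (hb : IsBoundary b) (ht₀ : 0 < t₀) (hx₀ : x₀ < b t₀) [SigmaFinite μ]
    (hμ : D1Optimal b t₀ x₀ μ) (hlam : P1Optimal b t₀ x₀ (Ioc 0 t₀) lam) :
    ∀ᵐ t ∂lam, imageIntegral μ t (b t) = 1 := by
  have := hlam.1.1.1
  have hbd : imageIntegral μ t₀ x₀ ≤ 1 := by
    refine le_trans (lintegral_mono_ae ?_) (hμ.1.2 t₀ ⟨ht₀, le_rfl⟩)
    filter_upwards [hμ.1.1.ae_mem] with θ hθ
    apply ENNReal.ofReal_le_ofReal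
    apply Real.exp_le_exp.2
    have : 0 ≤ θ := by linarith [hb.pos, mem_Ici.1 hθ]
    gcongr
  have hne : imageIntegral μ t₀ x₀ ≠ ∞ := ne_top_of_le_ne_top ENNReal.one_ne_top hbd
  obtain ⟨lam', hlam', hle⟩ := exists_p1Admissible_le (x₀ := x₀) hb ht₀
    (v := (imageIntegral μ t₀ x₀).toReal) ENNReal.toReal_nonneg
    (fun μ' h1 h2 => by rw [ENNReal.ofReal_toReal hne]; exact hμ.2 μ' h1 h2)
  rw [ENNReal.ofReal_toReal hne] at hle
  have h1 : (fun t => imageIntegral μ t (b t)) ≤ᵐ[lam] fun _ => 1 := by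
    filter_upwards [hlam.1.1.2.ae_mem] with t ht using hμ.1.2 t ht
  refine ae_eq_of_ae_le_of_lintegral_le h1 ?_ aemeasurable_const ?_
  · exact ne_top_of_le_ne_top (by simp) (lintegral_mono_ae h1)
  -- The mass of `lam` is at most that of `lam'`, hence at most the value of `μ`, hence at most the
  -- double integral; with `h1` this forces equality almost everywhere.
  · rw [lintegral_one, lintegral_imageIntegral hb hlam.1.1]
    refine ((hlam.2 lam' hlam').trans hle).trans (lintegral_mono_ae ?_)
    filter_upwards [hμ.1.1.ae_mem] with θ hθ using hlam.1.2 θ hθ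

/-- Complementary slackness for `(P₂)` and `(D₂)`. -/
theorem p2Optimal_ae_eq_one {b : ℝ → ℝ} {t₀ x₀ : ℝ} {μ lam : Measure ℝ}
    (hb : IsBoundary b) (ht₀ : 0 < t₀) [SigmaFinite μ]
    (hμ : P2Optimal b t₀ x₀ μ) (hlam : D2Optimal b t₀ x₀ (Ioc 0 t₀) lam) :
    ∀ᵐ t ∂lam, imageIntegral μ t (b t) = 1 := by
  have := hlam.1.1.1
  have hle : imageIntegral μ t₀ x₀ ≤ lam univ := by
    -- The value of `μ` is not known to be finite, so it is approached by real lower bounds `m`.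
    have hreal : ∀ m : ℝ, ENNReal.ofReal m ≤ imageIntegral μ t₀ x₀ → m ≤ lam.real univ := by
      intro m hm
      have hlim : Tendsto (fun η : ℝ => (1 - η) * m) (𝓝[>] 0) (𝓝 m) := by
        have : Continuous fun η : ℝ => (1 - η) * m := by fun_prop
        simpa using (this.tendsto 0).mono_left nhdsWithin_le_nhds
      refine le_of_tendsto hlim ?_
      filter_upwards [Ioo_mem_nhdsGT one_pos] with η hη
      obtain ⟨lam', hlam', hmass⟩ := exists_d2Admissible_ge hb ht₀
        (fun μ' h1 h2 => hm.trans (hμ.2 μ' h1 h2)) hη.1 hη.2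
      have h := hmass.trans (hlam.2 lam' hlam')
      rwa [← ofReal_measureReal, ENNReal.ofReal_le_ofReal_iff measureReal_nonneg] at h
    refine ENNReal.le_of_forall_nnreal_lt fun r hr => ?_
    have := hreal r (by simpa using hr.le)
    rw [← ofReal_measureReal, ← ENNReal.ofReal_coe_nnreal]
    exact ENNReal.ofReal_le_ofReal this
  have h1 : (fun _ => 1) ≤ᵐ[lam] fun t => imageIntegral μ t (b t) := by
    filter_upwards [hlam.1.1.2.ae_mem] with t ht using hμ.1.2 t ht
  refine (ae_eq_of_ae_le_of_lintegral_le h1 (by simp)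
    (aemeasurable_uncurry_imageKernel hb hlam.1.1.2).lintegral_prod_right' ?_).mono
    fun t ht => ht.symm
  rw [lintegral_one, lintegral_imageIntegral hb hlam.1.1]
  refine le_trans (lintegral_mono_ae ?_) hle
  filter_upwards [hμ.1.1.ae_mem] with θ hθ using hlam.1.2 θ hθ

end ImagesLP

open ImagesLP in
theorem theorem5p5 (b : ℝ → ℝ) (t₀ x₀ : ℝ) (ht₀ : 0 < t₀) (hx₀ : x₀ < b t₀)
    (hB : ImagesLP.AssumptionB b t₀ x₀)
    (μ₁ μ₂ lam₁ lam₂ : Measure ℝ)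
    (hμ₁ : ImagesLP.D1Optimal b t₀ x₀ μ₁)
    (hμ₂ : ImagesLP.P2Optimal b t₀ x₀ μ₂)
    (hlam₁ : ImagesLP.P1Optimal b t₀ x₀ (Ioc 0 t₀) lam₁)
    (hlam₂ : ImagesLP.D2Optimal b t₀ x₀ (Ioc 0 t₀) lam₂)
    (hint : ∃ tstar : ℝ, t₀ < tstar ∧
      ∫⁻ θ in Ioi 0, ENNReal.ofReal (Real.exp (-θ ^ 2 / (2 * tstar))) ∂μ₁ < ∞ ∧
      ∫⁻ θ in Ioi 0, ENNReal.ofReal (Real.exp (-θ ^ 2 / (2 * tstar))) ∂μ₂ < ∞)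
    (hcond : lam₁ {t₀} = 0 ∨ ∀ ε ∈ Ioo 0 t₀, 0 < lam₂ (Icc (t₀ - ε) t₀)) :
    ImagesLP.RepresentableUpTo b t₀ := by
  have hb := hB.boundary
  obtain ⟨T, hT, hint₁, hint₂⟩ := hint
  have hsub : Ici (2 * b 0) ⊆ Ioi 0 := fun θ hθ => by
    have := hb.pos
    exact lt_of_lt_of_le (by linarith) (mem_Ici.1 hθ)
  have hpos {μ : Measure ℝ} (h : IsMeasureOn (Ici (2 * b 0)) μ) : IsMeasureOn (Ioi 0) μ :=
    measure_mono_null (compl_subset_compl.2 hsub) h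
  have hmeas : Measurable fun θ : ℝ => Real.exp (-θ ^ 2 / (2 * T)) := by fun_prop
  rcases hcond with h | h
  · have hμ := hpos hμ₁.1.1
    rw [Measure.restrict_eq_self_of_ae_mem hμ.ae_mem] at hint₁
    have := sigmaFinite_of_lintegral_ofReal_lt_top hmeas (fun _ => Real.exp_pos _) hint₁
    refine representableUpTo_of_ae_eq_one hb ht₀ hT hμ hint₁
      (d1Optimal_ae_eq_one hb ht₀ hx₀ hμ₁ hlam₁) fun s hs h0 => ?_
    refine hlam₁.1.measure_Ioc_ne_zero hb hs ?_
    rw [← Ioo_insert_right hs.2]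
    exact measure_union_null h h0
  · have hμ := hpos hμ₂.1.1
    rw [Measure.restrict_eq_self_of_ae_mem hμ.ae_mem] at hint₂
    have := sigmaFinite_of_lintegral_ofReal_lt_top hmeas (fun _ => Real.exp_pos _) hint₂
    refine representableUpTo_of_ae_eq_one hb ht₀ hT hμ hint₂
      (p2Optimal_ae_eq_one hb ht₀ hμ₂ hlam₂) fun s hs h0 => ?_
    -- Half the distance to `s` keeps the closed interval inside `(s, t₀]`.
    have h1 := h ((t₀ - s) / 2) ⟨by linarith [hs.2], by linarith [hs.1]⟩
    refine h1.ne' (measure_mono_null (t := {t₀} ∪ Ioo s t₀) ?_ (measure_union_null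
      (hlam₂.1.measure_singleton_eq_zero ht₀ hx₀) h0))
    rintro t ⟨ht1, ht2⟩
    rcases ht2.eq_or_lt with rfl | ht2
    · exact Or.inl rfl
    · exact Or.inr ⟨by linarith [hs.2], ht2⟩
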